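/- Let $a,b,c,d>0$ be real numbers, and let $\{W_n(z)\}_{n\ge 0}$ be the polynomial sequence with $W_0(z)=1$, $W_1(z)=z$ and \[ W_n(z)=(az+b)W_{n-1}(z)+(cz+d)W_{n-2}(z)\qquad(n\ge 2). \] A complex number $x$ is a limit of zeros of $\{W_n\}$ if there is a complex zero $z_n$ of $W_n$ for each $n\ge 1$ such that $\lim_{n\to\infty}z_n=x$; such an $x$ is non-isolated if it is a limit point of the set of all limits of zeros. Let $\Delta_\Delta=-a^2d+abc+c^2$, $\Delta_g=(b+c)^2+4d(1-a)$, \[ x_\Delta^{\pm}=\frac{-ab-2c\pm 2\sqrt{\Delta_\Delta}}{a^2},\qquad x_g^{\pm}=\begin{cases}\dfrac{b+c}{2(1-a)}\pm\dfrac{\sqrt{\Delta_g}}{2|1-a|}, & a\ne 1,\\[2mm] -\dfrac{d}{b+c}, & a=1,\end{cases} \] where $x_\Delta^\pm$ are complex numbers if $\Delta_\Delta<0$ (with $\sqrt{\Delta_\Delta}=i\sqrt{|\Delta_\Delta|}$). Then the points $-b/a$, $x_\Delta^-$ and $x_\Delta^+$ are non-isolated limits of zeros of $\{W_n\}$. Moreover,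 when $ad<bc$ (in which case $\Delta_\Delta>0$ and $\Delta_g>0$), the set of all limits of zeros of $\{W_n\}$ in $\mathbb{C}$ is \[ \begin{cases} [x_\Delta^-,x_\Delta^+]\cup\{x_g^-\}, & \text{if } 0<a\le 1,\\ [x_\Delta^-,x_\Delta^+]\cup\{x_g^+\}, & \text{if } 1<a\le 2, \text{ or if } a>2 \text{ and } \Delta_\Delta\le\Delta_g,\\ [x_\Delta^-,x_\Delta^+]\cup\{x_g^-,x_g^+\}, & \text{if } a>2 \text{ and } \Delta_\Delta>\Delta_g. \end{cases} \] -/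

import Mathlib

open Polynomial Filter Topology

noncomputable section

namespace RootGeometry

/-- The polynomials defined by `W₀ = 1`, `W₁ = z` and
`Wₙ = (a z + b) Wₙ₋₁ + (c z + d) Wₙ₋₂`, as polynomials over `ℂ`. -/
def W (a b c d : ℝ) : ℕ → ℂ[X]
  | 0 => 1
  | 1 => X
  | n + 2 => (C (a : ℂ) * X + C (b : ℂ)) * W a b c d (n + 1)
      + (C (c : ℂ) * X + C (d : ℂ)) * W a b c d n

/-- `x` is a limit of zeros of the sequence `P`: one can pick a zero `z n` of `P n` for each
`n ≥ 1` so that `z n → x`. The index `0` is left out since `W₀ = 1` has no zero. -/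
def IsLimitOfZeros (P : ℕ → ℂ[X]) (x : ℂ) : Prop :=
  ∃ z : ℕ → ℂ, (∀ n, 1 ≤ n → (P n).IsRoot (z n)) ∧ Tendsto z atTop (𝓝 x)

/-- The set of all limits of zeros. -/
def limitsOfZeros (P : ℕ → ℂ[X]) : Set ℂ := {x | IsLimitOfZeros P x}

/-- A limit of zeros that is a limit point of the set of all limits of zeros. -/
def IsNonisolatedLimitOfZeros (P : ℕ → ℂ[X]) (x : ℂ) : Prop :=
  IsLimitOfZeros P x ∧ AccPt x (𝓟 (limitsOfZeros P))

/-- The number `Δ_Δ`. -/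
def discDelta (a b c d : ℝ) : ℝ := -a ^ 2 * d + a * b * c + c ^ 2

/-- The number `Δ_g`. -/
def discG (a b c d : ℝ) : ℝ := (b + c) ^ 2 + 4 * d * (1 - a)

/-- `x_Δ⁺` as a complex number: `Δ_Δ` may be negative when `ad > bc`, and the square root is the
principal one (`i √|Δ_Δ|` for `Δ_Δ < 0`). -/
def xDeltaPlus (a b c d : ℝ) : ℂ :=
  (-(a : ℂ) * b - 2 * c + 2 * Complex.sqrt (discDelta a b c d)) / (a : ℂ) ^ 2

/-- `x_Δ⁻` as a complex number. -/
def xDeltaMinus (a b c d : ℝ) : ℂ :=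
  (-(a : ℂ) * b - 2 * c - 2 * Complex.sqrt (discDelta a b c d)) / (a : ℂ) ^ 2

/-- `x_Δ⁺` as a real number, meaningful when `Δ_Δ ≥ 0`. -/
def xDeltaPlusReal (a b c d : ℝ) : ℝ :=
  (-a * b - 2 * c + 2 * Real.sqrt (discDelta a b c d)) / a ^ 2

/-- `x_Δ⁻` as a real number, meaningful when `Δ_Δ ≥ 0`. -/
def xDeltaMinusReal (a b c d : ℝ) : ℝ :=
  (-a * b - 2 * c - 2 * Real.sqrt (discDelta a b c d)) / a ^ 2

open Classical in
/-- `x_g⁺`, meaningful when `Δ_g ≥ 0`. -/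
def xGPlus (a b c d : ℝ) : ℝ :=
  if a = 1 then -d / (b + c)
  else (b + c) / (2 * (1 - a)) + Real.sqrt (discG a b c d) / (2 * |1 - a|)

open Classical in
/-- `x_g⁻`, meaningful when `Δ_g ≥ 0`. -/
def xGMinus (a b c d : ℝ) : ℝ :=
  if a = 1 then -d / (b + c)
  else (b + c) / (2 * (1 - a)) - Real.sqrt (discG a b c d) / (2 * |1 - a|)

theorem discDelta_pos {a b c d : ℝ} (ha : 0 < a) (hc : 0 < c) (h : a * d ≤ b * c) :
    0 < discDelta a b c d := by
  unfold discDelta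
  nlinarith [mul_nonneg ha.le (sub_nonneg.2 h), pow_pos hc 2]

theorem discG_pos {a b c d : ℝ} (hd : 0 < d) (h : a * d ≤ b * c) :
    0 < discG a b c d := by
  unfold discG
  nlinarith [sq_nonneg (b - c)]

theorem sqrt_ofReal_of_nonneg {x : ℝ} (hx : 0 ≤ x) :
    Complex.sqrt (x : ℂ) = (Real.sqrt x : ℂ) := by
  rw [Complex.sqrt, Real.sqrt_eq_rpow, Complex.ofReal_cpow hx]
  norm_num

/-- The real and the complex `x_Δ⁺` agree when `Δ_Δ ≥ 0`. -/
theorem xDeltaPlus_eq {a b c d : ℝ} (h : 0 ≤ discDelta a b c d) :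
    xDeltaPlus a b c d = (xDeltaPlusReal a b c d : ℂ) := by
  unfold xDeltaPlus xDeltaPlusReal
  rw [sqrt_ofReal_of_nonneg h]
  push_cast
  rfl

/-- The real and the complex `x_Δ⁻` agree when `Δ_Δ ≥ 0`. -/
theorem xDeltaMinus_eq {a b c d : ℝ} (h : 0 ≤ discDelta a b c d) :
    xDeltaMinus a b c d = (xDeltaMinusReal a b c d : ℂ) := by
  unfold xDeltaMinus xDeltaMinusReal
  rw [sqrt_ofReal_of_nonneg h]
  push_cast
  rfl

end RootGeometry

end

namespace RootGeometry

/-! Write `A = a z + b`, `B = c z + d`, `g = z² - A z - B`, and let `l`, `m` be the roots of `λ² - A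
λ - B`. Binet's formula `(l - m) Wₙ = (z - m) lⁿ - (z - l) mⁿ` governs everything; note that `g = (z
- l)(z - m)`.

If `|m| < |l|` at a limit of zeros `x`, dividing by `lⁿ` and passing to the limit gives `x = m`: so
`g(x) = 0` and `x` is dominated by the other root `A - x`. Equal moduli mean `l, m = r exp (± i θ)`
with `θ` real, that is `A² + 4 t B = 0` with `t = cos² θ` in `[0, 1]`. This is
`curve_or_dominated_of_mem_limitsOfZeros`.

Conversely, near a generic curve point `Wₙ = 0` reads `exp (2 i n θ) = (z - l)/(z - m)` in a complex
variable `θ`, and a contraction argument solves it close to any given real `θ`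
(`eventually_exists_exp_eq`, `mem_limitsOfZeros_of_param`). Only finitely many parameters `t` are
exceptional and the set of limits is closed, so every point approximable along the curve is a
non-isolated limit; `-b/a` belongs to `t = 0` and `x_Δ^±` to `t = 1`. A real dominated root of `g`
is a limit because `Wₙ` changes sign across it (`mem_limitsOfZeros_of_dominated`).

For `a d < b c` the curve is the real interval `[x_Δ⁻, x_Δ⁺]`, and it remains to decide which roots
`x_g^±` of `g` are dominated. -/

/-! ### Binet's formula and degrees -/

theorem eval_W_add_two (a b c d : ℝ) (n : ℕ) (z : ℂ) :
    (W a b c d (n + 2)).eval z =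
      (a * z + b) * (W a b c d (n + 1)).eval z + (c * z + d) * (W a b c d n).eval z := by
  simp [W]

/-- Binet's formula for `W`, in terms of the two roots `l`, `m` of the characteristic equation. -/
theorem sub_mul_eval_W (a b c d : ℝ) {z l m : ℂ} (hadd : l + m = a * z + b)
    (hmul : l * m = -(c * z + d)) (n : ℕ) :
    (l - m) * (W a b c d n).eval z = (z - m) * l ^ n - (z - l) * m ^ n := by
  induction n using Nat.twoStepInduction with
  | zero => simp [W]
  | one => simp [W]; ring
  | more n h0 h1 =>
    rw [eval_W_add_two, ← hadd, ← neg_eq_iff_eq_neg.2 hmul]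
    linear_combination (l + m) * h1 - l * m * h0

theorem natDegree_W_le (a b c d : ℝ) (n : ℕ) : (W a b c d n).natDegree ≤ n := by
  induction n using Nat.twoStepInduction with
  | zero => simp [W]
  | one => simp [W]
  | more n h0 h1 =>
    rw [W]
    have hlin (u v : ℂ) : (C u * X + C v).natDegree ≤ 1 := natDegree_linear_le
    refine natDegree_add_le_of_degree_le ?_ ?_
    · exact (natDegree_mul_le_of_le (hlin _ _) h1).trans (by omega)
    · exact (natDegree_mul_le_of_le (hlin _ _) h0).trans (by omega)

theorem coeff_W_succ (a b c d : ℝ) (n : ℕ) :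
    (W a b c d (n + 1)).coeff (n + 1) = (a : ℂ) ^ n := by
  induction n with
  | zero => simp [W]
  | succ n ih =>
    have h1 : (W a b c d (n + 1)).coeff (n + 2) = 0 :=
      coeff_eq_zero_of_natDegree_lt (lt_of_le_of_lt (natDegree_W_le a b c d _) (by omega))
    have h2 : (W a b c d n).coeff (n + 1) = 0 :=
      coeff_eq_zero_of_natDegree_lt (lt_of_le_of_lt (natDegree_W_le a b c d _) (by omega))
    have h3 : (W a b c d n).coeff (n + 2) = 0 :=
      coeff_eq_zero_of_natDegree_lt (lt_of_le_of_lt (natDegree_W_le a b c d _) (by omega))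
    rw [W]
    simp only [add_mul, coeff_add, mul_assoc, coeff_C_mul, coeff_X_mul, ih, h1, h2, h3]
    ring

theorem exists_isRoot_W {a : ℝ} (ha : a ≠ 0) (b c d : ℝ) {n : ℕ} (hn : 1 ≤ n) :
    ∃ z, (W a b c d n).IsRoot z := by
  obtain ⟨n, rfl⟩ := Nat.exists_eq_add_of_le' hn
  apply Complex.exists_root
  refine lt_of_lt_of_le ?_ (le_degree_of_ne_zero (n := n + 1) ?_)
  · exact_mod_cast n.succ_pos
  · rw [coeff_W_succ]
    exact pow_ne_zero _ (by exact_mod_cast ha)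

/-! ### Limits of zeros as a closed set -/

/-- Choosing for each `n` a zero nearest to `x` turns the `ε`-condition into one convergent
sequence. -/
theorem mem_limitsOfZeros_iff {P : ℕ → ℂ[X]} (hP : ∀ n, 1 ≤ n → ∃ z, (P n).IsRoot z) {x : ℂ} :
    x ∈ limitsOfZeros P ↔ ∀ ε > 0, ∀ᶠ n in atTop, ∃ z, (P n).IsRoot z ∧ dist z x < ε := by
  constructor
  · rintro ⟨z, hz, hlim⟩ ε hε
    filter_upwards [eventually_ge_atTop 1, Metric.tendsto_nhds.1 hlim ε hε] with n hn hd
    exact ⟨z n, hz n hn, hd⟩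
  · intro h
    have hnear (n : ℕ) : ∃ z, 1 ≤ n →
        (P n).IsRoot z ∧ ∀ y, (P n).IsRoot y → dist z x ≤ dist y x := by
      by_cases hn : 1 ≤ n
      · have hc : IsClosed {z | (P n).IsRoot z} := isClosed_eq (P n).continuous continuous_const
        obtain ⟨z, hz, hd⟩ := hc.exists_infDist_eq_dist (hP n hn) x
        refine ⟨z, fun _ => ⟨hz, fun y hy => ?_⟩⟩
        rw [dist_comm z, dist_comm y, ← hd]
        exact Metric.infDist_le_dist_of_mem hy
      · exact ⟨0, fun h => absurd h hn⟩
    choose z hz using hnear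
    refine ⟨z, fun n hn => (hz n hn).1, Metric.tendsto_nhds.2 fun ε hε => ?_⟩
    filter_upwards [eventually_ge_atTop 1, h ε hε] with n hn ⟨y, hy, hd⟩
    exact ((hz n hn).2 y hy).trans_lt hd

theorem isClosed_limitsOfZeros {P : ℕ → ℂ[X]} (hP : ∀ n, 1 ≤ n → ∃ z, (P n).IsRoot z) :
    IsClosed (limitsOfZeros P) := by
  refine isClosed_of_closure_subset fun x hx => (mem_limitsOfZeros_iff hP).2 fun ε hε => ?_
  obtain ⟨y, hy, hd⟩ := Metric.mem_closure_iff.1 hx (ε / 2) (half_pos hε)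
  filter_upwards [(mem_limitsOfZeros_iff hP).1 hy (ε / 2) (half_pos hε)] with n ⟨z, hz, hzy⟩
  exact ⟨z, hz, by linarith [dist_triangle z y x, dist_comm x y]⟩

/-! ### Generic points of the curve -/

/-- For `ψ` locally Lipschitz, the equation `exp (2 i n θ) = exp (ψ θ)` has, for large `n`,
solutions as close as one likes to a given real number. -/
theorem eventually_exists_exp_eq {ψ : ℂ → ℂ} {x : ℝ} {K : NNReal} {s : Set ℂ}
    (hs : s ∈ 𝓝 (x : ℂ)) (hψ : LipschitzOnWith K ψ s) {t : Set ℂ} (ht : t ∈ 𝓝 (x : ℂ)) :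
    ∀ᶠ n : ℕ in atTop, ∃ θ ∈ t, Complex.exp (2 * Complex.I * n * θ) = Complex.exp (ψ θ) := by
  obtain ⟨ε, hε, hst⟩ := Metric.nhds_basis_closedBall.mem_iff.1 (inter_mem hs ht)
  have hψ' := hψ.mono (hst.trans Set.inter_subset_left)
  set S := Metric.closedBall (x : ℂ) ε
  have hxS : (x : ℂ) ∈ S := Metric.mem_closedBall_self hε.le
  set M := ‖ψ x‖ + K * ε
  have hM : ∀ θ ∈ S, ‖ψ θ‖ ≤ M := by
    intro θ hθ
    have h1 := hψ'.dist_le_mul θ hθ x hxS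
    rw [dist_eq_norm] at h1
    have h2 : (K : ℝ) * dist θ x ≤ K * ε :=
      mul_le_mul_of_nonneg_left (Metric.mem_closedBall.1 hθ) K.2
    have h3 := norm_add_le (ψ θ - ψ x) (ψ x)
    rw [sub_add_cancel] at h3
    linarith
  -- The first term makes `T` below map the ball to itself, as `(π + M)/n ≤ ε`; the term `K` makes
  -- its Lipschitz constant `K/(2n)` at most `1/2`.
  have hlarge : ∀ᶠ n : ℕ in atTop, (Real.pi + M) / ε + K + 1 ≤ (n : ℝ) :=
    tendsto_natCast_atTop_atTop.eventually_ge_atTop _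
  filter_upwards [hlarge] with n hn
  have hMnn : 0 ≤ M := (norm_nonneg _).trans (hM x hxS)
  have hfrac : 0 ≤ (Real.pi + M) / ε := div_nonneg (add_nonneg Real.pi_pos.le hMnn) hε.le
  have hKnn : (0 : ℝ) ≤ K := K.2
  have hn0 : (0 : ℝ) < n := by linarith
  have hn0' : (n : ℂ) ≠ 0 := by exact_mod_cast hn0.ne'
  have hnorm : ‖2 * Complex.I * (n : ℂ)‖ = 2 * n := by simp
  -- A fixed point of `T` satisfies `2 i n θ = ψ θ + 2 π i k`; this `k` puts `π k / n` within `π /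
  -- n` of `x`.
  set k := ⌊n * x / Real.pi⌋
  let T : ℂ → ℂ := fun θ => Real.pi * k / n + ψ θ / (2 * Complex.I * n)
  have hk : |Real.pi * k / n - x| ≤ Real.pi / n := by
    have h1 := Int.floor_le (n * x / Real.pi)
    have h2 := Int.lt_floor_add_one (n * x / Real.pi)
    rw [le_div_iff₀ Real.pi_pos] at h1
    rw [div_lt_iff₀ Real.pi_pos] at h2
    have : Real.pi * k / n - x = (Real.pi * k - n * x) / n := by field_simp
    rw [this, abs_div, abs_of_pos hn0]
    gcongr
    rw [abs_le]
    constructor <;> linarith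
  have hmaps : Set.MapsTo T S S := by
    intro θ hθ
    rw [Metric.mem_closedBall, dist_eq_norm]
    have e : T θ - x = ((Real.pi * k / n - x : ℝ) : ℂ) + ψ θ / (2 * Complex.I * n) := by
      simp only [T]; push_cast; ring
    rw [e]
    refine (norm_add_le _ _).trans ?_
    rw [Complex.norm_real, norm_div, hnorm, Real.norm_eq_abs]
    have h1 : ‖ψ θ‖ / (2 * n) ≤ M / n := by
      gcongr
      · exact hM θ hθ
      · linarith
    have h2 : (Real.pi + M) / n ≤ ε := by
      rw [div_le_comm₀ hn0 hε]; linarith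
    rw [add_div] at h2
    linarith
  have hcontr : ContractingWith (1 / 2) (hmaps.restrict T S S) := by
    refine ⟨by rw [← NNReal.coe_lt_coe]; norm_num, LipschitzWith.of_dist_le_mul ?_⟩
    rintro ⟨u, hu⟩ ⟨v, hv⟩
    simp only [Subtype.dist_eq, Set.MapsTo.val_restrict_apply]
    have e : T u - T v = (ψ u - ψ v) / (2 * Complex.I * n) := by simp only [T]; ring
    rw [dist_eq_norm, e, norm_div, hnorm, ← dist_eq_norm, div_le_iff₀ (by positivity)]
    refine (hψ'.dist_le_mul u hu v hv).trans ?_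
    have : (K : ℝ) * dist u v ≤ n * dist u v := by
      gcongr
      linarith
    push_cast
    linarith
  obtain ⟨θ, hθS, hfix, -⟩ := hcontr.exists_fixedPoint' Metric.isClosed_closedBall.isComplete
    hmaps hxS (edist_ne_top _ _)
  refine ⟨θ, (hst hθS).2, ?_⟩
  have hfix' : Real.pi * k / n + ψ θ / (2 * Complex.I * n) = θ := hfix
  have : 2 * Complex.I * n * θ = ψ θ + k * (2 * Real.pi * Complex.I) := by
    conv_lhs => rw [← hfix']
    field_simp [Complex.I_ne_zero]
    ring
  rw [this, Complex.exp_add, Complex.exp_int_mul_two_pi_mul_I, mul_one]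

/-- If the characteristic roots at `ζ θ` are `r θ * exp (± i θ)` for `θ` near a real number `x`
and neither equals `ζ x` at `θ = x`, then `ζ x` is a limit of zeros. -/
theorem mem_limitsOfZeros_of_param {a b c d : ℝ} (ha : a ≠ 0) {x : ℝ} {r ζ : ℂ → ℂ}
    (hr : AnalyticAt ℂ r x) (hζ : AnalyticAt ℂ ζ x) (hr0 : r x ≠ 0) (hsin : Real.sin x ≠ 0)
    (hadd : ∀ᶠ θ in 𝓝 (x : ℂ), 2 * r θ * Complex.cos θ = a * ζ θ + b)
    (hmul : ∀ᶠ θ in 𝓝 (x : ℂ), r θ ^ 2 = -(c * ζ θ + d))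
    (hg : ζ x ^ 2 - (a * ζ x + b) * ζ x - (c * ζ x + d) ≠ 0) :
    ζ x ∈ limitsOfZeros (W a b c d) := by
  rw [mem_limitsOfZeros_iff fun n hn => exists_isRoot_W ha b c d hn]
  intro ε hε
  have haddx := hadd.self_of_nhds
  have hmulx := hmul.self_of_nhds
  have hexp (θ : ℂ) : Complex.exp (θ * Complex.I) * Complex.exp (-θ * Complex.I) = 1 := by
    rw [← Complex.exp_add]; simp
  have hcos (θ : ℂ) :
      Complex.exp (θ * Complex.I) + Complex.exp (-θ * Complex.I) = 2 * Complex.cos θ := by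
    rw [Complex.cos]; ring
  have hsinI (θ : ℂ) : Complex.exp (θ * Complex.I) - Complex.exp (-θ * Complex.I)
      = 2 * Complex.I * Complex.sin θ := by
    rw [Complex.sin]; linear_combination
      (Complex.exp (θ * Complex.I) - Complex.exp (-θ * Complex.I)) * Complex.I_sq
  let p : ℂ → ℂ := fun θ => ζ θ - r θ * Complex.exp (θ * Complex.I)
  let m : ℂ → ℂ := fun θ => ζ θ - r θ * Complex.exp (-θ * Complex.I)
  -- The product is `g` at `ζ x`.
  have hpm : p x * m x ≠ 0 := by
    convert hg using 1
    simp only [p, m]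
    linear_combination (-(ζ x) * r x) * hcos x + r x ^ 2 * hexp x - ζ x * haddx + hmulx
  have hp0 : p x ≠ 0 := left_ne_zero_of_mul hpm
  have hm0 : m x ≠ 0 := right_ne_zero_of_mul hpm
  have hp : AnalyticAt ℂ p x := by fun_prop
  have hm : AnalyticAt ℂ m x := by fun_prop
  let φ : ℂ → ℂ := fun θ => p θ / m θ
  have hφ0 : φ x ≠ 0 := div_ne_zero hp0 hm0
  have hφ : AnalyticAt ℂ φ x := hp.div hm hm0
  -- A logarithm of `φ`, normalised at `x` so that it is analytic there even if `φ x` is a negative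
  -- real.
  let ψ : ℂ → ℂ := fun θ => Complex.log (φ θ / φ x) + Complex.log (φ x)
  have hψ : AnalyticAt ℂ ψ x := by
    refine AnalyticAt.add (AnalyticAt.clog (hφ.div analyticAt_const hφ0) ?_) analyticAt_const
    rw [div_self hφ0]
    exact Complex.one_mem_slitPlane
  obtain ⟨K, s, hs, hL⟩ := (hψ.contDiffAt (n := 1)).exists_lipschitzOnWith
  have hsin' : ∀ᶠ θ in 𝓝 (x : ℂ), Complex.sin θ ≠ 0 :=
    Complex.continuous_sin.continuousAt.eventually_ne (by exact_mod_cast hsin)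
  have hclose : ∀ᶠ θ in 𝓝 (x : ℂ), dist (ζ θ) (ζ x) < ε :=
    Metric.tendsto_nhds.1 hζ.continuousAt ε hε
  have hev : {θ : ℂ | 2 * r θ * Complex.cos θ = a * ζ θ + b ∧ r θ ^ 2 = -(c * ζ θ + d) ∧
      Complex.sin θ ≠ 0 ∧ dist (ζ θ) (ζ x) < ε ∧ p θ ≠ 0 ∧ m θ ≠ 0 ∧ r θ ≠ 0} ∈ 𝓝 (x : ℂ) := by
    filter_upwards [hadd, hmul, hsin', hclose, hp.continuousAt.eventually_ne hp0,
      hm.continuousAt.eventually_ne hm0, hr.continuousAt.eventually_ne hr0]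
      with θ h1 h2 h3 h4 h5 h6 h7 using ⟨h1, h2, h3, h4, h5, h6, h7⟩
  filter_upwards [eventually_exists_exp_eq hs hL hev] with n ⟨θ, ⟨h1, h2, h3, h4, h5, h6, h7⟩, h8⟩
  refine ⟨ζ θ, ?_, h4⟩
  have hψθ : Complex.exp (ψ θ) = p θ / m θ := by
    have : φ θ ≠ 0 := div_ne_zero h5 h6
    rw [Complex.exp_add, Complex.exp_log (div_ne_zero this hφ0), Complex.exp_log hφ0,
      div_mul_cancel₀ _ hφ0]
  rw [hψθ, eq_div_iff h6] at h8
  have hbinet := sub_mul_eval_W a b c d (z := ζ θ) (l := r θ * Complex.exp (θ * Complex.I))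
    (m := r θ * Complex.exp (-θ * Complex.I)) (by linear_combination h1 + r θ * hcos θ)
    (by linear_combination h2 + r θ ^ 2 * hexp θ) n
  have hpow : Complex.exp (θ * Complex.I) ^ n
      = Complex.exp (-θ * Complex.I) ^ n * Complex.exp (2 * Complex.I * n * θ) := by
    rw [← Complex.exp_nat_mul, ← Complex.exp_nat_mul, ← Complex.exp_add]
    congr 1; ring
  have hzero : (r θ * Complex.exp (θ * Complex.I) - r θ * Complex.exp (-θ * Complex.I))
      * (W a b c d n).eval (ζ θ) = 0 := by
    rw [hbinet, mul_pow, mul_pow, hpow]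
    simp only [p, m] at h8
    linear_combination (r θ ^ n * Complex.exp (-θ * Complex.I) ^ n) * h8
  refine (mul_eq_zero.1 hzero).resolve_left ?_
  rw [← mul_sub, hsinI]
  exact mul_ne_zero h7 (mul_ne_zero (by simp) h3)

/-- With `t = cos² x`, the curve point is extended to an analytic family in `θ`. The hypothesis `hD`
says that `z` is a simple root of the curve equation, which lets the square root in the family be
analytic. -/
theorem mem_limitsOfZeros_of_generic {a b c d : ℝ} (ha : a ≠ 0) {t : ℝ} (ht0 : 0 < t)
    (ht1 : t < 1) {z : ℂ} (hz : (a * z + b) ^ 2 + 4 * t * (c * z + d) = 0) (hA : a * z + b ≠ 0)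
    (hD : a * (a * z + b) + 2 * c * t ≠ 0)
    (hg : z ^ 2 - (a * z + b) * z - (c * z + d) ≠ 0) :
    z ∈ limitsOfZeros (W a b c d) := by
  have haC : (a : ℂ) ≠ 0 := by exact_mod_cast ha
  set x := Real.arccos (Real.sqrt t)
  have hcosx : Real.cos x = Real.sqrt t :=
    Real.cos_arccos (by linarith [Real.sqrt_nonneg t]) (Real.sqrt_le_one.2 ht1.le)
  have hcos2 : Complex.cos x ^ 2 = t := by
    rw [← Complex.ofReal_cos, hcosx]
    exact_mod_cast Real.sq_sqrt ht0.le
  have hcos0 : Complex.cos x ≠ 0 := by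
    intro h
    rw [h] at hcos2
    have : (t : ℂ) = 0 := by rw [← hcos2]; ring
    exact ht0.ne' (by exact_mod_cast this)
  have hsin : Real.sin x ≠ 0 := by
    have h1 := Real.sin_sq_add_cos_sq x
    rw [hcosx, Real.sq_sqrt ht0.le] at h1
    intro h
    rw [h] at h1
    linarith
  let r₀ : ℂ := (a * z + b) / (2 * Complex.cos x)
  have hr₀ : r₀ * (2 * Complex.cos x) = a * z + b := div_mul_cancel₀ _ (by simpa using hcos0)
  have hr₀2 : r₀ ^ 2 = -(c * z + d) := by
    have : 4 * Complex.cos x ^ 2 * (r₀ ^ 2 + (c * z + d)) = 0 := by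
      linear_combination hz + (r₀ * (2 * Complex.cos x) + (a * z + b)) * hr₀
        + 4 * (c * z + d) * hcos2
    have h2 := (mul_eq_zero.1 this).resolve_left (by simpa using hcos0)
    linear_combination h2
  let σ : ℂ := a * r₀ + c * Complex.cos x
  have hσ0 : σ ≠ 0 := by
    intro h
    apply hD
    have : σ * (2 * Complex.cos x) = 0 := by rw [h, zero_mul]
    simp only [σ] at this
    linear_combination this - a * hr₀ - 2 * c * hcos2
  -- Eliminating `ζ` from `2 r cos θ = a ζ + b` and `r² = -(c ζ + d)` gives `a r² + 2 c cos θ r + a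
  -- d - b c = 0`. `D` is a quarter of its discriminant, and `σ` is the square root of `D x`
  -- selecting `r₀`.
  let D : ℂ → ℂ := fun θ => a * (b * c - a * d) + c ^ 2 * Complex.cos θ ^ 2
  have hDx : D x = σ ^ 2 := by
    simp only [D, σ]
    linear_combination (- (a : ℂ) ^ 2) * hr₀2 - a * c * hr₀
  have hDx0 : D x ≠ 0 := by rw [hDx]; exact pow_ne_zero _ hσ0
  let S : ℂ → ℂ := fun θ => σ * Complex.exp (Complex.log (D θ / D x) / 2)
  have hDan : AnalyticAt ℂ D x := by fun_prop
  have hS : AnalyticAt ℂ S x := by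
    have : AnalyticAt ℂ (fun θ => Complex.log (D θ / D x)) x := by
      refine AnalyticAt.clog (hDan.div analyticAt_const hDx0) ?_
      rw [div_self hDx0]
      exact Complex.one_mem_slitPlane
    fun_prop
  have hSx : S x = σ := by simp [S, div_self hDx0]
  have hS2 : ∀ᶠ θ in 𝓝 (x : ℂ), S θ ^ 2 = D θ := by
    filter_upwards [hDan.continuousAt.eventually_ne hDx0] with θ hθ
    simp only [S]
    rw [mul_pow, ← Complex.exp_nat_mul, ← hDx]
    push_cast
    rw [mul_div_cancel₀ _ (two_ne_zero), Complex.exp_log (div_ne_zero hθ hDx0),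
      mul_div_cancel₀ _ hDx0]
  let r : ℂ → ℂ := fun θ => (S θ - c * Complex.cos θ) / a
  let ζ : ℂ → ℂ := fun θ => (2 * r θ * Complex.cos θ - b) / a
  have hr : AnalyticAt ℂ r x := by
    simp only [r, div_eq_mul_inv]; fun_prop
  have hζ : AnalyticAt ℂ ζ x := by
    simp only [ζ, div_eq_mul_inv]; fun_prop
  have hrx : r x = r₀ := by
    simp only [r, hSx, σ]; field_simp; ring
  have hζx : ζ x = z := by
    simp only [ζ, hrx]
    rw [div_eq_iff haC]
    linear_combination hr₀
  rw [← hζx]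
  refine mem_limitsOfZeros_of_param ha hr hζ ?_ hsin ?_ ?_ ?_
  · rw [hrx]
    exact div_ne_zero hA (by simpa using hcos0)
  · refine Eventually.of_forall fun θ => ?_
    simp only [ζ]
    field_simp
    ring
  · filter_upwards [hS2] with θ hθ
    simp only [ζ, r, D] at hθ ⊢
    field_simp
    linear_combination hθ
  · rwa [hζx]

/-! ### Approximation along the curve -/

/-- Some root of a quadratic polynomial is close to any point at which its value is small. -/
theorem exists_quadratic_root_near {α β γ : ℂ} (hα : α ≠ 0) (z₀ : ℂ) :
    ∃ z, α * z ^ 2 + β * z + γ = 0 ∧ ‖α‖ * dist z z₀ ^ 2 ≤ ‖α * z₀ ^ 2 + β * z₀ + γ‖ := by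
  obtain ⟨s, hs⟩ := IsAlgClosed.exists_eq_mul_self (discrim α β γ)
  obtain ⟨z, hz⟩ := exists_quadratic_eq_zero hα ⟨s, hs⟩
  have hz' : α * z ^ 2 + β * z + γ = 0 := by linear_combination hz
  set y := -β / α - z
  have hy : α * (z + y) = -β := by simp only [y]; field_simp; ring
  have hfac (x : ℂ) : α * x ^ 2 + β * x + γ = α * ((z - x) * (y - x)) := by
    linear_combination (x - z) * hy + hz'
  have hnorm : ‖α * z₀ ^ 2 + β * z₀ + γ‖ = ‖α‖ * (dist z z₀ * dist y z₀) := by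
    rw [hfac, norm_mul, norm_mul, dist_eq_norm, dist_eq_norm]
  rcases le_total (dist z z₀) (dist y z₀) with h | h
  · refine ⟨z, hz', ?_⟩
    rw [hnorm, sq]
    gcongr
  · refine ⟨y, by rw [hfac y]; ring, ?_⟩
    rw [hnorm, sq]
    gcongr

/-- A double root in `z` with `t ≠ 0` forces `t = (a² d - a b c)/c²`. The other exceptions are roots
of `g`, finite in number, and each determines `t = -A²/(4 B)`, where `B ≠ 0` because `A ≠ 0`. -/
theorem finite_nongeneric_param {c d : ℝ} (a b : ℝ) (hc : c ≠ 0) (hd : d ≠ 0) :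
    {t : ℝ | ∃ z : ℂ, t ≠ 0 ∧ (a * z + b) ^ 2 + 4 * t * (c * z + d) = 0 ∧ a * z + b ≠ 0 ∧
      (a * (a * z + b) + 2 * c * t = 0 ∨
        z ^ 2 - (a * z + b) * z - (c * z + d) = 0)}.Finite := by
  have hg : {z : ℂ | z ^ 2 - (a * z + b) * z - (c * z + d) = 0}.Finite := by
    let p : ℂ[X] := X ^ 2 - (C (a : ℂ) * X + C (b : ℂ)) * X - (C (c : ℂ) * X + C (d : ℂ))
    have hp : p ≠ 0 := by
      intro h
      have h0 : p.eval 0 = 0 := by rw [h, eval_zero]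
      simp [p, hd] at h0
    refine (p.finite_setOfPred_isRoot hp).subset fun z hz => ?_
    simpa [p] using hz
  have him := (hg.image fun z : ℂ => -(a * z + b) ^ 2 / (4 * (c * z + d))).preimage
    (Complex.ofReal_injective.injOn (s := _))
  refine (him.insert ((a ^ 2 * d - a * b * c) / c ^ 2)).subset ?_
  rintro t ⟨z, ht, hz, hA, h | h⟩
  · left
    have htC : (t : ℂ) ≠ 0 := by exact_mod_cast ht
    have h1 : (4 * t : ℂ) * (c ^ 2 * t - (a ^ 2 * d - a * b * c)) = 0 := by
      linear_combination (-(a : ℂ) ^ 2) * hz + (a * (a * z + b) + 2 * c * t) * h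
    have h2 := (mul_eq_zero.1 h1).resolve_left (mul_ne_zero (by norm_num) htC)
    have h3 : c ^ 2 * t - (a ^ 2 * d - a * b * c) = 0 := by exact_mod_cast h2
    rw [eq_div_iff (pow_ne_zero _ hc)]
    linarith
  · right
    refine ⟨z, h, ?_⟩
    have hB : (c * z + d : ℂ) ≠ 0 := by
      intro hB
      rw [hB, mul_zero, add_zero] at hz
      exact hA (pow_eq_zero_iff two_ne_zero |>.1 hz)
    change -(a * z + b) ^ 2 / (4 * (c * z + d)) = (t : ℂ)
    rw [div_eq_iff (mul_ne_zero (by norm_num) hB)]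
    linear_combination -hz

/-- A point that is approximated by points of the curve `A² + 4 t B = 0`, `0 < t < 1`, is a
non-isolated limit of zeros. -/
theorem isNonisolatedLimitOfZeros_of_approx {a b c d : ℝ} (ha : a ≠ 0) (hc : c ≠ 0) (hd : d ≠ 0)
    {t₀ : ℝ} (ht₀ : t₀ ∈ Set.Icc (0 : ℝ) 1) {z₀ : ℂ}
    (h : ∀ ε > 0, ∃ δ > 0, ∀ t ∈ Set.Ioo (0 : ℝ) 1, t ≠ t₀ → |t - t₀| < δ →
      ∃ z : ℂ, a * z + b ≠ 0 ∧ (a * z + b) ^ 2 + 4 * t * (c * z + d) = 0 ∧ z ≠ z₀ ∧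
        dist z z₀ < ε) :
    IsNonisolatedLimitOfZeros (W a b c d) z₀ := by
  have key : ∀ ε > 0, ∃ z ∈ limitsOfZeros (W a b c d), z ≠ z₀ ∧ dist z z₀ < ε := by
    intro ε hε
    obtain ⟨δ, hδ, hz⟩ := h ε hε
    have hlt : max 0 (t₀ - δ) < min 1 (t₀ + δ) := by
      obtain ⟨h0, h1⟩ := ht₀
      simp only [max_lt_iff, lt_min_iff]
      refine ⟨⟨?_, ?_⟩, ?_, ?_⟩ <;> linarith
    obtain ⟨t, ⟨hmax, hmin⟩, hbad⟩ := ((Set.Ioo_infinite hlt).sdiff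
      ((finite_nongeneric_param a b hc hd).insert t₀)).nonempty
    simp only [max_lt_iff, lt_min_iff] at hmax hmin
    have hne : t ≠ t₀ := fun e => hbad (Or.inl e)
    obtain ⟨z, hA, hzt, hzz, hdist⟩ := hz t ⟨hmax.1, hmin.1⟩ hne
      (abs_lt.2 ⟨by linarith, by linarith⟩)
    refine ⟨z, mem_limitsOfZeros_of_generic ha hmax.1 hmin.1 hzt hA (fun e => hbad (Or.inr ?_))
      (fun e => hbad (Or.inr ?_)), hzz, hdist⟩
    · exact ⟨z, hmax.1.ne', hzt, hA, Or.inl e⟩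
    · exact ⟨z, hmax.1.ne', hzt, hA, Or.inr e⟩
  constructor
  · refine (isClosed_limitsOfZeros fun n hn => exists_isRoot_W ha b c d hn).closure_subset
      (Metric.mem_closure_iff.2 fun ε hε => ?_)
    obtain ⟨z, hz, -, hd⟩ := key ε hε
    exact ⟨z, hz, by rwa [dist_comm]⟩
  · rw [accPt_iff_nhds]
    intro u hu
    obtain ⟨ε, hε, hsub⟩ := Metric.mem_nhds_iff.1 hu
    obtain ⟨z, hz, hne, hd⟩ := key ε hε
    exact ⟨z, ⟨hsub hd, hz⟩, hne⟩

/-- Near a point of the curve `A² + 4 t B = 0` at the parameter `t₀` there are points of the curve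
at all parameters close to `t₀`. -/
theorem exists_curve_point_near {a b c d t₀ : ℝ} (ha : a ≠ 0) {z₀ : ℂ}
    (hz₀ : (a * z₀ + b) ^ 2 + 4 * t₀ * (c * z₀ + d) = 0) {ε : ℝ} (hε : 0 < ε) :
    ∃ δ > 0, ∀ t : ℝ, |t - t₀| < δ →
      ∃ z : ℂ, (a * z + b) ^ 2 + 4 * t * (c * z + d) = 0 ∧ dist z z₀ < ε := by
  have ha2 : 0 < a ^ 2 := by positivity
  -- At `z₀` the quadratic for `t` has value `4 (t - t₀) (c z₀ + d)`, which bounds `a² dist²`; the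
  -- `+ 1` keeps the denominator positive.
  refine ⟨a ^ 2 * ε ^ 2 / (4 * ‖(c * z₀ + d : ℂ)‖ + 1), by positivity, fun t ht => ?_⟩
  obtain ⟨z, hz, hd⟩ := exists_quadratic_root_near (α := (a : ℂ) ^ 2)
    (β := 2 * a * b + 4 * t * c) (γ := b ^ 2 + 4 * t * d)
    (pow_ne_zero 2 (by exact_mod_cast ha)) z₀
  refine ⟨z, by linear_combination hz, ?_⟩
  have e : (a : ℂ) ^ 2 * z₀ ^ 2 + (2 * a * b + 4 * t * c) * z₀ + (b ^ 2 + 4 * t * d)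
      = ((t - t₀ : ℝ) : ℂ) * (4 * (c * z₀ + d)) := by
    push_cast
    linear_combination hz₀
  rw [e, norm_mul, norm_mul, norm_pow, Complex.norm_real, Complex.norm_real, Real.norm_eq_abs,
    Real.norm_eq_abs, sq_abs, Complex.norm_ofNat] at hd
  rw [lt_div_iff₀ (by positivity)] at ht
  have h1 : a ^ 2 * dist z z₀ ^ 2 < a ^ 2 * ε ^ 2 := by
    nlinarith [abs_nonneg (t - t₀), sq_nonneg ε, mul_pos ha2 (pow_pos hε 2)]
  exact lt_of_pow_lt_pow_left₀ 2 hε.le (lt_of_mul_lt_mul_left h1 ha2.le)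

theorem isNonisolatedLimitOfZeros_of_curve {a b c d : ℝ} (ha : a ≠ 0) (hc : c ≠ 0) (hd : d ≠ 0)
    {t₀ : ℝ} (ht₀ : t₀ ∈ Set.Icc (0 : ℝ) 1) {z₀ : ℂ}
    (hz₀ : (a * z₀ + b) ^ 2 + 4 * t₀ * (c * z₀ + d) = 0) (hA : a * z₀ + b ≠ 0) :
    IsNonisolatedLimitOfZeros (W a b c d) z₀ := by
  refine isNonisolatedLimitOfZeros_of_approx ha hc hd ht₀ fun ε hε => ?_
  have hcont : ContinuousAt (fun z : ℂ => a * z + b) z₀ := by fun_prop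
  obtain ⟨η, hη, hball⟩ := Metric.eventually_nhds_iff.1 (hcont.eventually_ne hA)
  obtain ⟨δ, hδ, h⟩ := exists_curve_point_near ha hz₀ (lt_min hε hη)
  refine ⟨δ, hδ, fun t _ hne ht => ?_⟩
  obtain ⟨z, hz, hdist⟩ := h t ht
  refine ⟨z, hball (hdist.trans_le (min_le_right _ _)), hz, ?_,
    hdist.trans_le (min_le_left _ _)⟩
  rintro rfl
  have h1 : ((t - t₀ : ℝ) : ℂ) * (4 * (c * z + d)) = 0 := by
    push_cast
    linear_combination hz - hz₀
  have h2 := (mul_eq_zero.1 h1).resolve_left (by exact_mod_cast sub_ne_zero.2 hne)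
  refine hA (pow_eq_zero_iff two_ne_zero |>.1 ?_)
  linear_combination hz₀ - t₀ * h2

theorem isNonisolatedLimitOfZeros_neg_div {a b c d : ℝ} (ha : a ≠ 0) (hc : c ≠ 0) (hd : d ≠ 0) :
    IsNonisolatedLimitOfZeros (W a b c d) ((-b / a : ℝ) : ℂ) := by
  have haC : (a : ℂ) ≠ 0 := by exact_mod_cast ha
  have hcC : (c : ℂ) ≠ 0 := by exact_mod_cast hc
  have hA : a * ((-b / a : ℝ) : ℂ) + b = 0 := by
    push_cast
    field_simp
    ring
  refine isNonisolatedLimitOfZeros_of_approx (t₀ := 0) ha hc hd (by simp) fun ε hε => ?_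
  -- If `a d = b c` then `B = (c/a) A`, so the curve equation factors and `A = -4 t c / a` must be
  -- chosen explicitly to avoid `A = 0`. Otherwise `A` and `B` have no common zero, so `A ≠ 0` is
  -- automatic for `t ≠ 0`.
  by_cases hdeg : a * d = b * c
  · have hdegC : (a * d : ℂ) = b * c := by exact_mod_cast hdeg
    have hpos : 0 < 4 * |c| / a ^ 2 := by positivity
    refine ⟨ε / (4 * |c| / a ^ 2), by positivity, fun t ht _ htd => ?_⟩
    have htC : (t : ℂ) ≠ 0 := by exact_mod_cast ht.1.ne'
    have hAz : a * ((-4 * t * c / a - b) / a : ℂ) + b = -4 * t * c / a := by field_simp; ring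
    have hAz0 : a * ((-4 * t * c / a - b) / a : ℂ) + b ≠ 0 := by
      rw [hAz]
      exact div_ne_zero (mul_ne_zero (mul_ne_zero (by norm_num) htC) hcC) haC
    refine ⟨(-4 * t * c / a - b) / a, hAz0, ?_, ?_, ?_⟩
    · rw [hAz]
      field_simp
      linear_combination (4 * t * a : ℂ) * hdegC
    · intro h
      rw [h] at hAz0
      exact hAz0 hA
    · have e : ((-4 * t * c / a - b) / a : ℂ) - ((-b / a : ℝ) : ℂ)
          = ((-(4 * c / a ^ 2) * t : ℝ) : ℂ) := by
        push_cast
        field_simp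
        ring
      rw [sub_zero, lt_div_iff₀ hpos] at htd
      rw [dist_eq_norm, e, Complex.norm_real, Real.norm_eq_abs, abs_mul, abs_neg, abs_div, abs_mul,
        abs_of_pos (by positivity : 0 < a ^ 2), abs_of_pos (by norm_num : (0 : ℝ) < 4)]
      linarith
  · obtain ⟨δ, hδ, h⟩ := exists_curve_point_near (a := a) (b := b) (c := c) (d := d) (t₀ := 0)
      (z₀ := ((-b / a : ℝ) : ℂ)) ha (by rw [hA]; simp) hε
    refine ⟨δ, hδ, fun t ht _ htd => ?_⟩
    obtain ⟨z, hz, hdist⟩ := h t htd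
    have htC : (t : ℂ) ≠ 0 := by exact_mod_cast ht.1.ne'
    have hAz : a * z + b ≠ 0 := by
      intro h0
      rw [h0] at hz
      have h1 : (4 * t : ℂ) * (c * z + d) = 0 := by linear_combination hz
      have h2 := (mul_eq_zero.1 h1).resolve_left (mul_ne_zero (by norm_num) htC)
      have h3 : (a * d : ℂ) = b * c := by linear_combination a * h2 - c * h0
      exact hdeg (by exact_mod_cast h3)
    refine ⟨z, hAz, hz, ?_, hdist⟩
    rintro rfl
    exact hAz hA

/-! ### Limits of zeros lie on the curve or are dominated roots -/

/-- Positivity of the real part of this square root singles out the dominant characteristic root `A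
(1 + w)/2`. -/
theorem re_exp_log_div_two_pos {u : ℂ} (hu : u ∈ Complex.slitPlane) :
    0 < (Complex.exp (Complex.log u / 2)).re := by
  have him : (Complex.log u / 2).im = Complex.arg u / 2 := by
    rw [Complex.div_ofNat_im, Complex.log_im]
  rw [Complex.exp_re, him]
  refine mul_pos (Real.exp_pos _) (Real.cos_pos_of_mem_Ioo ⟨?_, ?_⟩)
  · linarith [Complex.neg_pi_lt_arg u]
  · have := (Complex.arg_le_pi u).lt_of_ne (Complex.mem_slitPlane_iff_arg.1 hu).1
    linarith

theorem norm_one_sub_lt_norm_one_add {w : ℂ} (hw : 0 < w.re) : ‖1 - w‖ < ‖1 + w‖ := by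
  refine lt_of_pow_lt_pow_left₀ 2 (norm_nonneg _) ?_
  rw [Complex.sq_norm, Complex.sq_norm, Complex.normSq_apply, Complex.normSq_apply]
  simp only [Complex.sub_re, Complex.add_re, Complex.one_re, Complex.sub_im, Complex.add_im,
    Complex.one_im]
  nlinarith

/-- A limit of zeros at which the two characteristic roots have different absolute values is a
point at which the dominant one has coefficient zero in Binet's formula. -/
theorem curve_or_dominated_of_mem_limitsOfZeros {a b c d : ℝ} {x : ℂ}
    (hx : x ∈ limitsOfZeros (W a b c d)) :
    (∃ t ∈ Set.Icc (0 : ℝ) 1, (a * x + b) ^ 2 + 4 * t * (c * x + d) = 0) ∨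
      (x ^ 2 - (a * x + b) * x - (c * x + d) = 0 ∧ ‖x‖ < ‖a * x + b - x‖) := by
  rw [or_iff_not_imp_left]
  intro hcurve
  obtain ⟨z, hz, hlim⟩ := hx
  have hA : a * x + b ≠ 0 := fun h => hcurve ⟨0, by simp, by rw [h]; simp⟩
  -- The characteristic discriminant over `A²`. A value `u ≤ 0` would place `x` on the curve with `t
  -- = 1/(1 - u)`.
  let u : ℂ → ℂ := fun y => 1 + 4 * (c * y + d) / (a * y + b) ^ 2
  have hux : u x ∈ Complex.slitPlane := by
    by_contra hu
    rw [Complex.mem_slitPlane_iff, not_or, not_lt, not_not] at hu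
    obtain ⟨hre, him⟩ := hu
    have hur : u x = ((u x).re : ℂ) := Complex.ext rfl (by simp [him])
    have hpos : 0 < 1 - (u x).re := by linarith
    refine hcurve ⟨(1 - (u x).re)⁻¹, ⟨by positivity, inv_le_one_of_one_le₀ (by linarith)⟩, ?_⟩
    have h1 : 4 * (c * x + d) = ((u x).re - 1) * (a * x + b) ^ 2 := by
      rw [← hur]
      simp only [u]
      rw [add_sub_cancel_left, div_mul_cancel₀ _ (pow_ne_zero 2 hA)]
    have h2 : (1 - (u x).re : ℂ) ≠ 0 := by exact_mod_cast hpos.ne'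
    push_cast
    field_simp
    linear_combination h1
  let w : ℂ → ℂ := fun y => Complex.exp (Complex.log (u y) / 2)
  let l : ℂ → ℂ := fun y => (a * y + b) * (1 + w y) / 2
  let m : ℂ → ℂ := fun y => (a * y + b) * (1 - w y) / 2
  have hu : ContinuousAt u x := by
    have : (a * x + b) ^ 2 ≠ 0 := pow_ne_zero 2 hA
    simp only [u]
    fun_prop (disch := assumption)
  have hw : ContinuousAt w x := by
    have := hu.clog hux
    fun_prop
  have hl : ContinuousAt l x := by fun_prop
  have hm : ContinuousAt m x := by fun_prop
  have hwre : 0 < (w x).re := re_exp_log_div_two_pos hux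
  have hml : ‖m x‖ < ‖l x‖ := by
    simp only [m, l, norm_div, norm_mul]
    have := norm_one_sub_lt_norm_one_add hwre
    have := norm_pos_iff.2 hA
    gcongr
    simp
  have hlx : l x ≠ 0 := norm_pos_iff.1 ((norm_nonneg _).trans_lt hml)
  have hadd (y : ℂ) : l y + m y = a * y + b := by simp only [l, m]; ring
  have hmul (y : ℂ) (h1 : u y ≠ 0) (h2 : a * y + b ≠ 0) : l y * m y = -(c * y + d) := by
    have h3 : w y ^ 2 = u y := by
      simp only [w]
      rw [← Complex.exp_nat_mul]
      push_cast
      rw [mul_div_cancel₀ _ two_ne_zero, Complex.exp_log h1]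
    have h4 : u y * (a * y + b) ^ 2 = (a * y + b) ^ 2 + 4 * (c * y + d) := by
      simp only [u]
      rw [add_mul, one_mul, div_mul_cancel₀ _ (pow_ne_zero 2 h2)]
    simp only [l, m]
    linear_combination (-(a * y + b) ^ 2 / 4) * h3 - h4 / 4
  have hux0 : u x ≠ 0 := Complex.slitPlane_ne_zero hux
  have hlin : ContinuousAt (fun y : ℂ => a * y + b) x := by fun_prop
  have hq : Tendsto (fun n => m (z n) / l (z n)) atTop (𝓝 (m x / l x)) :=
    (hm.div₀ hl hlx).tendsto.comp hlim
  have hqx : ‖m x / l x‖ < 1 := by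
    rwa [norm_div, div_lt_one (norm_pos_iff.2 hlx)]
  obtain ⟨ρ, hρ1, hρ2⟩ := exists_between hqx
  have hρ0 : 0 ≤ ρ := (norm_nonneg _).trans hρ1.le
  have hqn : Tendsto (fun n => (m (z n) / l (z n)) ^ n) atTop (𝓝 0) := by
    refine squeeze_zero_norm' ?_ (tendsto_pow_atTop_nhds_zero_of_lt_one hρ0 hρ2)
    filter_upwards [hq.norm.eventually_lt_const hρ1] with n hn
    rw [norm_pow]
    exact pow_le_pow_left₀ (norm_nonneg _) hn.le n
  have hlz : Tendsto (fun n => l (z n)) atTop (𝓝 (l x)) := hl.tendsto.comp hlim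
  have hmz : Tendsto (fun n => m (z n)) atTop (𝓝 (m x)) := hm.tendsto.comp hlim
  have heq : ∀ᶠ n in atTop, (z n - l (z n)) * (m (z n) / l (z n)) ^ n = z n - m (z n) := by
    filter_upwards [eventually_ge_atTop 1, hlim.eventually (hu.eventually_ne hux0),
      hlim.eventually (hlin.eventually_ne hA), hlim.eventually (hl.eventually_ne hlx)]
      with n hn h1 h2 h3
    have hb := sub_mul_eval_W a b c d (hadd (z n)) (hmul (z n) h1 h2) n
    rw [(hz n hn).eq_zero, mul_zero] at hb
    rw [div_pow, mul_div_assoc', div_eq_iff (pow_ne_zero n h3)]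
    linear_combination hb
  have hxm : x - m x = 0 := by
    have h1 := (hlim.sub hlz).mul hqn
    rw [mul_zero] at h1
    exact tendsto_nhds_unique (hlim.sub hmz) (h1.congr' heq)
  have hmx : m x = x := (sub_eq_zero.1 hxm).symm
  constructor
  · linear_combination (x - l x) * hxm + x * hadd x - hmul x hux0 hA
  · have : a * x + b - x = l x := by linear_combination -(hadd x) + hmx
    rw [this]
    rwa [hmx] at hml

/-! ### Dominated real roots are limits of zeros -/

theorem exists_real_W (a b c d : ℝ) (n : ℕ) :
    ∃ p : ℝ[X], ∀ y : ℝ, (W a b c d n).eval (y : ℂ) = (p.eval y : ℝ) := by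
  have h : ∃ p : ℝ[X], W a b c d n = p.map Complex.ofRealHom := by
    induction n using Nat.twoStepInduction with
    | zero => exact ⟨1, by simp [W]⟩
    | one => exact ⟨X, by simp [W]⟩
    | more n h0 h1 =>
      obtain ⟨p, hp⟩ := h0
      obtain ⟨q, hq⟩ := h1
      exact ⟨(C a * X + C b) * q + (C c * X + C d) * p, by simp [W, hp, hq]⟩
  obtain ⟨p, hp⟩ := h
  refine ⟨p, fun y => ?_⟩
  rw [hp, eval_map, ← Complex.ofRealHom_eq_coe, eval₂_at_apply]
  rfl

/-- After dividing by `lⁿ` the second term tends to zero. The product form records agreement of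
signs without splitting on the sign of `lⁿ`. -/
theorem eventually_dominant_pos {u v l m : ℝ} (hu : u ≠ 0) (hml : |m| < |l|) :
    ∀ᶠ n : ℕ in atTop, 0 < u * l ^ n * (u * l ^ n - v * m ^ n) := by
  have hl : l ≠ 0 := abs_pos.1 ((abs_nonneg _).trans_lt hml)
  have hq : |m / l| < 1 := by rwa [abs_div, div_lt_one (abs_pos.2 hl)]
  have hlim : Tendsto (fun n : ℕ => u - v * (m / l) ^ n) atTop (𝓝 u) := by
    simpa using ((tendsto_pow_atTop_nhds_zero_of_abs_lt_one hq).const_mul v).const_sub u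
  have hlim' := (hlim.const_mul u).eventually_const_lt (mul_self_pos.2 hu)
  filter_upwards [hlim'] with n hn
  have e : u * l ^ n * (u * l ^ n - v * m ^ n)
      = (l ^ n) ^ 2 * (u * (u - v * (m / l) ^ n)) := by
    have := pow_ne_zero n hl
    rw [div_pow]
    field_simp
  rw [e]
  have : l ^ n ≠ 0 := pow_ne_zero n hl
  positivity

theorem mul_pos_of_mul_pos_of_mul_pos {p q r : ℝ} (hp : 0 < p * r) (hq : 0 < q * r) :
    0 < p * q := by
  have e : p * r * (q * r) = p * q * r ^ 2 := by ring
  have h := mul_pos hp hq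
  rw [e] at h
  exact pos_of_mul_pos_left h (sq_nonneg r)

theorem sub_mul_pos_of_abs_lt {l m : ℝ} (h : |m| < |l|) : 0 < (l - m) * l := by
  have h1 : m * l ≤ |m| * |l| := (le_abs_self _).trans (abs_mul _ _).le
  have h2 : |m| * |l| < |l| * |l| := mul_lt_mul_of_pos_right h ((abs_nonneg _).trans_lt h)
  rw [abs_mul_abs_self] at h2
  linarith

/-- If the coefficients of the dominant characteristic roots `l₁`, `l₂` at `y₁` and `y₂` have
opposite signs, then `Wₙ` eventually has a zero between `y₁` and `y₂`. -/
theorem eventually_exists_root_Icc {a b c d y₁ y₂ l₁ m₁ l₂ m₂ : ℝ} (hle : y₁ ≤ y₂)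
    (hadd₁ : l₁ + m₁ = a * y₁ + b) (hmul₁ : l₁ * m₁ = -(c * y₁ + d))
    (hadd₂ : l₂ + m₂ = a * y₂ + b) (hmul₂ : l₂ * m₂ = -(c * y₂ + d))
    (h₁ : |m₁| < |l₁|) (h₂ : |m₂| < |l₂|) (hll : 0 < l₁ * l₂)
    (hmm : (y₁ - m₁) * (y₂ - m₂) < 0) :
    ∀ᶠ n : ℕ in atTop, ∃ y ∈ Set.Icc y₁ y₂, (W a b c d n).IsRoot (y : ℂ) := by
  have hdd : 0 < (l₁ - m₁) * (l₂ - m₂) := by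
    have e : (l₁ - m₁) * l₁ * ((l₂ - m₂) * l₂) = ((l₁ - m₁) * (l₂ - m₂)) * (l₁ * l₂) := by ring
    have hpos := mul_pos (sub_mul_pos_of_abs_lt h₁) (sub_mul_pos_of_abs_lt h₂)
    rw [e] at hpos
    exact pos_of_mul_pos_left hpos hll.le
  filter_upwards [eventually_dominant_pos (v := y₁ - l₁) (left_ne_zero_of_mul hmm.ne) h₁,
    eventually_dominant_pos (v := y₂ - l₂) (right_ne_zero_of_mul hmm.ne) h₂] with n hn₁ hn₂
  obtain ⟨p, hp⟩ := exists_real_W a b c d n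
  have hbinet {y l m : ℝ} (hadd : l + m = a * y + b) (hmul : l * m = -(c * y + d)) :
      (l - m) * p.eval y = (y - m) * l ^ n - (y - l) * m ^ n := by
    have := sub_mul_eval_W a b c d (z := y) (l := l) (m := m)
      (by exact_mod_cast hadd) (by exact_mod_cast hmul) n
    rw [hp] at this
    exact_mod_cast this
  rw [← hbinet hadd₁ hmul₁] at hn₁
  rw [← hbinet hadd₂ hmul₂] at hn₂
  have hsign : p.eval y₁ * p.eval y₂ < 0 := by
    have hlln : 0 < l₁ ^ n * l₂ ^ n := by rw [← mul_pow]; exact pow_pos hll n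
    have hprod := mul_pos hn₁ hn₂
    have e : (y₁ - m₁) * l₁ ^ n * ((l₁ - m₁) * p.eval y₁) *
        ((y₂ - m₂) * l₂ ^ n * ((l₂ - m₂) * p.eval y₂))
        = (((y₁ - m₁) * (y₂ - m₂)) * ((l₁ ^ n * l₂ ^ n) * ((l₁ - m₁) * (l₂ - m₂)))) *
          (p.eval y₁ * p.eval y₂) := by ring
    rw [e] at hprod
    by_contra! hc
    exact absurd hprod (mul_nonpos_of_nonpos_of_nonneg
      (mul_neg_of_neg_of_pos hmm (mul_pos hlln hdd)).le hc).not_gt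
  have hzero : ∃ y ∈ Set.Icc y₁ y₂, p.eval y = 0 := by
    have hc : ContinuousOn (fun y => p.eval y) (Set.Icc y₁ y₂) := p.continuous.continuousOn
    rcases mul_neg_iff.1 hsign with ⟨i, j⟩ | ⟨i, j⟩
    · exact intermediate_value_Icc' hle hc ⟨j.le, i.le⟩
    · exact intermediate_value_Icc hle hc ⟨i.le, j.le⟩
  obtain ⟨y, hy, hy0⟩ := hzero
  exact ⟨y, hy, by rw [IsRoot.def, hp, hy0, Complex.ofReal_zero]⟩

/-- At a simple real root `x` of `z² - A z - B` where the other characteristic root `A - x`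
dominates, the polynomials `Wₙ` eventually change sign. -/
theorem mem_limitsOfZeros_of_dominated {a b c d : ℝ} (ha : a ≠ 0) {x : ℝ}
    (hg : x ^ 2 - (a * x + b) * x - (c * x + d) = 0) (hsimple : 2 * (1 - a) * x - (b + c) ≠ 0)
    (hdom : |x| < |a * x + b - x|) : (x : ℂ) ∈ limitsOfZeros (W a b c d) := by
  rw [mem_limitsOfZeros_iff fun n hn => exists_isRoot_W ha b c d hn]
  intro ε hε
  have hA : a * x + b ≠ 0 := by
    intro h
    rw [h, zero_sub, abs_neg] at hdom
    exact lt_irrefl _ hdom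
  have hne : 2 * x - (a * x + b) ≠ 0 := by
    intro h
    rw [show a * x + b - x = x by linarith] at hdom
    exact lt_irrefl _ hdom
  let u : ℝ → ℝ := fun y => 1 + 4 * (c * y + d) / (a * y + b) ^ 2
  let l : ℝ → ℝ := fun y => (a * y + b) * (1 + Real.sqrt (u y)) / 2
  let m : ℝ → ℝ := fun y => (a * y + b) * (1 - Real.sqrt (u y)) / 2
  have hux : 0 < u x := by
    have e : u x = ((2 * x - (a * x + b)) / (a * x + b)) ^ 2 := by
      simp only [u]
      rw [div_pow, eq_div_iff (pow_ne_zero 2 hA), add_mul, one_mul,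
        div_mul_cancel₀ _ (pow_ne_zero 2 hA)]
      linear_combination -4 * hg
    rw [e]
    positivity
  have hu : ContinuousAt u x := by
    have : (a * x + b) ^ 2 ≠ 0 := pow_ne_zero 2 hA
    simp only [u]
    fun_prop (disch := assumption)
  have hl : ContinuousAt l x := by fun_prop
  have hlin : ContinuousAt (fun y : ℝ => a * y + b) x := by fun_prop
  have hadd (y : ℝ) : l y + m y = a * y + b := by simp only [l, m]; ring
  have hmul (y : ℝ) (h1 : 0 < u y) (h2 : a * y + b ≠ 0) : l y * m y = -(c * y + d) := by
    have h3 := Real.sq_sqrt h1.le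
    have h4 : u y * (a * y + b) ^ 2 = (a * y + b) ^ 2 + 4 * (c * y + d) := by
      simp only [u]
      rw [add_mul, one_mul, div_mul_cancel₀ _ (pow_ne_zero 2 h2)]
    simp only [l, m]
    linear_combination (-(a * y + b) ^ 2 / 4) * h3 - h4 / 4
  have hml (y : ℝ) (h1 : 0 < u y) (h2 : a * y + b ≠ 0) : |m y| < |l y| := by
    have h3 := Real.sqrt_pos.2 h1
    have h4 := abs_pos.2 h2
    simp only [l, m, abs_div, abs_mul]
    have h5 : |1 - √(u y)| < |1 + √(u y)| := by
      rw [abs_of_pos (by linarith : 0 < 1 + √(u y)), abs_lt]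
      constructor <;> linarith
    gcongr
  have hlx0 : l x ≠ 0 := abs_pos.1 ((abs_nonneg _).trans_lt (hml x hux hA))
  have hlx : x - l x ≠ 0 := by
    intro h
    have h1 := hml x hux hA
    rw [show m x = a * x + b - x by linarith [hadd x], show l x = x by linarith] at h1
    exact lt_asymm h1 hdom
  -- The cofactor in `g(y) = (y - x) h(y)`; `h x = g'(x)`.
  let h : ℝ → ℝ := fun y => (1 - a) * (y + x) - (b + c)
  have hh : ContinuousAt h x := by fun_prop
  have hhx : h x ≠ 0 := by
    intro e
    apply hsimple
    simp only [h] at e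
    linarith
  have hgy (y : ℝ) : y ^ 2 - (a * y + b) * y - (c * y + d) = (y - x) * h y := by
    simp only [h]
    linear_combination hg
  have hev : ∀ᶠ y in 𝓝 x, 0 < u y ∧ a * y + b ≠ 0 ∧ 0 < l y * l x ∧
      0 < (y - l y) * (x - l x) ∧ 0 < h y * h x := by
    have c1 : ContinuousAt (fun y => l y * l x) x := by fun_prop
    have c2 : ContinuousAt (fun y => (y - l y) * (x - l x)) x := by fun_prop
    have c3 : ContinuousAt (fun y => h y * h x) x := by fun_prop
    filter_upwards [hu.eventually_const_lt hux, hlin.eventually_ne hA,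
      c1.eventually_const_lt (mul_self_pos.2 hlx0), c2.eventually_const_lt (mul_self_pos.2 hlx),
      c3.eventually_const_lt (mul_self_pos.2 hhx)] with y h1 h2 h3 h4 h5 using ⟨h1, h2, h3, h4, h5⟩
  obtain ⟨δ, hδ, hball⟩ := Metric.eventually_nhds_iff.1 hev
  set η := min δ ε / 2
  have hη : 0 < η := half_pos (lt_min hδ hε)
  have hηδ : η < δ := (half_lt_self (lt_min hδ hε)).trans_le (min_le_left _ _)
  have hηε : η < ε := (half_lt_self (lt_min hδ hε)).trans_le (min_le_right _ _)
  obtain ⟨u1, A1, l1, s1, h1⟩ := hball (y := x - η)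
    (by rw [Real.dist_eq]; simpa [abs_of_pos hη] using hηδ)
  obtain ⟨u2, A2, l2, s2, h2⟩ := hball (y := x + η)
    (by rw [Real.dist_eq]; simpa [abs_of_pos hη] using hηδ)
  have hfac (y : ℝ) (h1 : 0 < u y) (h2 : a * y + b ≠ 0) :
      (y - m y) * (y - l y) = (y - x) * h y := by
    rw [← hgy]
    linear_combination (-y) * hadd y + hmul y h1 h2
  have hf1 := hfac _ u1 A1
  have hf2 := hfac _ u2 A2
  set y1 := x - η
  set y2 := x + η
  have hy1 : y1 - x = -η := by simp [y1]
  have hy2 : y2 - x = η := by simp [y2]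
  rw [hy1] at hf1
  rw [hy2] at hf2
  have hml1 := hml _ u1 A1
  have hml2 := hml _ u2 A2
  have hll : 0 < l y1 * l y2 := mul_pos_of_mul_pos_of_mul_pos l1 l2
  have hss : 0 < (y1 - l y1) * (y2 - l y2) := mul_pos_of_mul_pos_of_mul_pos s1 s2
  have hhh : 0 < h y1 * h y2 := mul_pos_of_mul_pos_of_mul_pos h1 h2
  -- `(y - m)(y - l) = g(y)` changes sign across `x` while `y - l` does not, so `y - m` does.
  have hmm : (y1 - m y1) * (y2 - m y2) < 0 := by
    have e : ((y1 - m y1) * (y2 - m y2)) * ((y1 - l y1) * (y2 - l y2))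
        = -(η ^ 2 * (h y1 * h y2)) := by
      linear_combination (y2 - m y2) * (y2 - l y2) * hf1 + (-η * h y1) * hf2
    have : 0 < η ^ 2 * (h y1 * h y2) := by positivity
    by_contra! hc
    have hnn := mul_nonneg hc hss.le
    rw [e] at hnn
    linarith
  filter_upwards [eventually_exists_root_Icc (by linarith : y1 ≤ y2) (hadd y1) (hmul y1 u1 A1)
    (hadd y2) (hmul y2 u2 A2) hml1 hml2 hll hmm] with n ⟨y, ⟨hya, hyb⟩, hy⟩
  refine ⟨y, hy, ?_⟩
  rw [Complex.dist_of_im_eq (by simp), Real.dist_eq, Complex.ofReal_re, Complex.ofReal_re]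
  exact (abs_le.2 ⟨by linarith, by linarith⟩).trans_lt hηε

/-! ### Curve endpoints and the interval for `a d < b c` -/

theorem isNonisolatedLimitOfZeros_of_discriminant_eq_zero {a b c d : ℝ} (ha : a ≠ 0) (hc : c ≠ 0)
    (hd : d ≠ 0) {z : ℂ} (hz : (a * z + b) ^ 2 + 4 * (c * z + d) = 0) :
    IsNonisolatedLimitOfZeros (W a b c d) z := by
  by_cases hA : a * z + b = 0
  · have haC : (a : ℂ) ≠ 0 := by exact_mod_cast ha
    have : z = ((-b / a : ℝ) : ℂ) := by
      push_cast
      rw [eq_div_iff haC]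
      linear_combination hA
    rw [this]
    exact isNonisolatedLimitOfZeros_neg_div ha hc hd
  · exact isNonisolatedLimitOfZeros_of_curve (t₀ := 1) ha hc hd (by simp)
      (by push_cast; linear_combination hz) hA

theorem csqrt_sq (z : ℂ) : Complex.sqrt z ^ 2 = z := by
  rw [Complex.sqrt, ← Complex.cpow_nat_mul]
  norm_num

theorem discriminant_xDeltaPlus {a : ℝ} (b c d : ℝ) (ha : a ≠ 0) :
    (a * xDeltaPlus a b c d + b) ^ 2 + 4 * (c * xDeltaPlus a b c d + d) = 0 := by
  have haC : (a : ℂ) ≠ 0 := by exact_mod_cast ha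
  have h := csqrt_sq (discDelta a b c d)
  have e : ((discDelta a b c d : ℝ) : ℂ) = -a ^ 2 * d + a * b * c + c ^ 2 := by
    simp [discDelta]
  unfold xDeltaPlus
  generalize Complex.sqrt (discDelta a b c d) = s at h
  rw [e] at h
  field_simp
  linear_combination 4 * h

theorem discriminant_xDeltaMinus {a : ℝ} (b c d : ℝ) (ha : a ≠ 0) :
    (a * xDeltaMinus a b c d + b) ^ 2 + 4 * (c * xDeltaMinus a b c d + d) = 0 := by
  have haC : (a : ℂ) ≠ 0 := by exact_mod_cast ha
  have h := csqrt_sq (discDelta a b c d)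
  have e : ((discDelta a b c d : ℝ) : ℂ) = -a ^ 2 * d + a * b * c + c ^ 2 := by
    simp [discDelta]
  unfold xDeltaMinus
  generalize Complex.sqrt (discDelta a b c d) = s at h
  rw [e] at h
  field_simp
  linear_combination 4 * h

theorem mem_Icc_xDelta_iff {a b c d : ℝ} (ha : 0 < a) (hD : 0 ≤ discDelta a b c d) (y : ℝ) :
    y ∈ Set.Icc (xDeltaMinusReal a b c d) (xDeltaPlusReal a b c d) ↔
      (a * y + b) ^ 2 + 4 * (c * y + d) ≤ 0 := by
  have ha2 : 0 < a ^ 2 := by positivity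
  have h1 : y ∈ Set.Icc (xDeltaMinusReal a b c d) (xDeltaPlusReal a b c d) ↔
      |a ^ 2 * y + a * b + 2 * c| ≤ 2 * Real.sqrt (discDelta a b c d) := by
    rw [Set.mem_Icc, xDeltaMinusReal, xDeltaPlusReal, div_le_iff₀ ha2, le_div_iff₀ ha2, abs_le]
    constructor <;> rintro ⟨h, h'⟩ <;> constructor <;> linarith
  have h2 := Real.sq_sqrt hD
  rw [h1, ← abs_of_nonneg (by positivity : 0 ≤ 2 * Real.sqrt (discDelta a b c d)), ← sq_le_sq,
    mul_pow, h2]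
  have e : (a ^ 2 * y + a * b + 2 * c) ^ 2 - 2 ^ 2 * discDelta a b c d
      = a ^ 2 * ((a * y + b) ^ 2 + 4 * (c * y + d)) := by
    unfold discDelta; ring
  rw [← sub_nonpos, e]
  exact ⟨fun h => nonpos_of_mul_nonpos_right h ha2, fun h =>
    mul_nonpos_of_nonneg_of_nonpos ha2.le h⟩

/-- Completing the square gives `(a² z + a b + 2 t c)² = 4 t (a b c + t c² - a² d)`. The right side
is nonnegative for `a d < b c`, so `z` is real; then `B ≤ 0` and `t ≤ 1` give `A² + 4 B ≤ 0`. -/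
theorem curve_iff_mem_Icc {a b c d : ℝ} (ha : 0 < a) (hc : 0 < c) (h : a * d < b * c) (z : ℂ) :
    (∃ t ∈ Set.Icc (0 : ℝ) 1, (a * z + b) ^ 2 + 4 * t * (c * z + d) = 0) ↔
      ∃ y ∈ Set.Icc (xDeltaMinusReal a b c d) (xDeltaPlusReal a b c d), (y : ℂ) = z := by
  have hD := (discDelta_pos ha hc h.le).le
  constructor
  · rintro ⟨t, ⟨ht0, ht1⟩, hz⟩
    have haC : (a : ℂ) ≠ 0 := by exact_mod_cast ha.ne'
    have hs : 0 ≤ 4 * t * (a * b * c + t * c ^ 2 - a ^ 2 * d) := by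
      have : 0 ≤ a * b * c + t * c ^ 2 - a ^ 2 * d := by
        nlinarith [mul_pos ha (sub_pos.2 h), mul_nonneg ht0 (sq_nonneg c)]
      positivity
    set s := Real.sqrt (4 * t * (a * b * c + t * c ^ 2 - a ^ 2 * d))
    have hs2 : (s : ℂ) ^ 2 = 4 * t * (a * b * c + t * c ^ 2 - a ^ 2 * d) := by
      exact_mod_cast Real.sq_sqrt hs
    have hsq : (a ^ 2 * z + a * b + 2 * t * c : ℂ) ^ 2 = (s : ℂ) ^ 2 := by
      rw [hs2]
      linear_combination (a : ℂ) ^ 2 * hz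
    have hreal : ∃ y : ℝ, (y : ℂ) = z := by
      rcases sq_eq_sq_iff_eq_or_eq_neg.1 hsq with e | e
      · refine ⟨(s - a * b - 2 * t * c) / a ^ 2, ?_⟩
        push_cast
        rw [← e]
        field_simp
        ring
      · refine ⟨(-s - a * b - 2 * t * c) / a ^ 2, ?_⟩
        push_cast
        rw [← e]
        field_simp
        ring
    obtain ⟨y, rfl⟩ := hreal
    refine ⟨y, (mem_Icc_xDelta_iff ha hD y).2 ?_, rfl⟩
    have hy : (a * y + b) ^ 2 + 4 * t * (c * y + d) = 0 := by exact_mod_cast hz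
    have hB : c * y + d ≤ 0 := by
      rcases ht0.eq_or_lt with rfl | ht
      · have hA : a * y + b = 0 := by
          have : (a * y + b) ^ 2 = 0 := by linarith
          exact pow_eq_zero_iff two_ne_zero |>.1 this
        by_contra! hB
        nlinarith [mul_pos ha hB]
      · by_contra! hB
        nlinarith [mul_pos ht hB, sq_nonneg (a * y + b)]
    nlinarith
  · rintro ⟨y, hy, rfl⟩
    have hy' := (mem_Icc_xDelta_iff ha hD y).1 hy
    have hB : c * y + d < 0 := by
      have hB' : c * y + d ≤ 0 := by nlinarith [sq_nonneg (a * y + b)]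
      refine hB'.lt_of_ne fun hB0 => ?_
      have hA : a * y + b = 0 := by
        refine pow_eq_zero_iff two_ne_zero |>.1 (le_antisymm ?_ (sq_nonneg (a * y + b)))
        linarith
      nlinarith
    have hB4 : 0 < -4 * (c * y + d) := by linarith
    refine ⟨(a * y + b) ^ 2 / (-4 * (c * y + d)), ⟨?_, ?_⟩, ?_⟩
    · exact div_nonneg (sq_nonneg _) hB4.le
    · rw [div_le_one hB4]
      linarith
    · have : (a * y + b) ^ 2 + 4 * ((a * y + b) ^ 2 / (-4 * (c * y + d))) * (c * y + d) = 0 := by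
        linear_combination -div_mul_cancel₀ ((a * y + b) ^ 2) hB4.ne'
      exact_mod_cast this

/-- For `a d < b c` the limits of zeros are the points of `[x_Δ⁻, x_Δ⁺]` and the roots of
`z² - A z - B` that are dominated by the other characteristic root. -/
theorem limitsOfZeros_eq {a b c d : ℝ} (ha : 0 < a) (hc : 0 < c) (hd : 0 < d)
    (h : a * d < b * c) :
    limitsOfZeros (W a b c d) =
      Complex.ofReal '' (Set.Icc (xDeltaMinusReal a b c d) (xDeltaPlusReal a b c d) ∪
        {y | y ^ 2 - (a * y + b) * y - (c * y + d) = 0 ∧ |y| < |a * y + b - y|}) := by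
  have hG := discG_pos hd h.le
  have hsimple (y : ℝ) (hy : y ^ 2 - (a * y + b) * y - (c * y + d) = 0) :
      2 * (1 - a) * y - (b + c) ≠ 0 := by
    intro e
    apply hG.ne'
    unfold discG
    linear_combination (-4 * (1 - a)) * hy + (2 * (1 - a) * y - (b + c)) * e
  ext z
  constructor
  · intro hz
    rcases curve_or_dominated_of_mem_limitsOfZeros hz with hK | ⟨hg, hdom⟩
    · obtain ⟨y, hy, rfl⟩ := (curve_iff_mem_Icc ha hc h z).1 hK
      exact ⟨y, Or.inl hy, rfl⟩
    · have hreal : ∃ y : ℝ, (y : ℂ) = z := by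
        by_cases ha1 : a = 1
        · have hbc : (b + c : ℂ) ≠ 0 := by
            intro e
            have e' : b + c = 0 := by exact_mod_cast e
            refine hG.ne' ?_
            unfold discG
            rw [e', ha1]
            ring
          refine ⟨-d / (b + c), ?_⟩
          push_cast
          rw [div_eq_iff hbc]
          rw [ha1] at hg
          push_cast at hg
          linear_combination hg
        · have ha1' : (2 * (1 - a) : ℂ) ≠ 0 :=
            mul_ne_zero two_ne_zero (by exact_mod_cast sub_ne_zero.2 (Ne.symm ha1))
          have hs2 : (Real.sqrt (discG a b c d) : ℂ) ^ 2 = (b + c) ^ 2 + 4 * d * (1 - a) := by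
            exact_mod_cast Real.sq_sqrt hG.le
          have hsq : (2 * (1 - a) * z - (b + c) : ℂ) ^ 2
              = (Real.sqrt (discG a b c d) : ℂ) ^ 2 := by
            rw [hs2]
            linear_combination (4 * (1 - a) : ℂ) * hg
          rcases sq_eq_sq_iff_eq_or_eq_neg.1 hsq with e | e
          · refine ⟨((b + c) + Real.sqrt (discG a b c d)) / (2 * (1 - a)), ?_⟩
            push_cast
            rw [div_eq_iff ha1']
            linear_combination -e
          · refine ⟨((b + c) - Real.sqrt (discG a b c d)) / (2 * (1 - a)), ?_⟩
            push_cast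
            rw [div_eq_iff ha1']
            linear_combination -e
      obtain ⟨y, rfl⟩ := hreal
      refine ⟨y, Or.inr ⟨by exact_mod_cast hg, ?_⟩, rfl⟩
      rw [← Real.norm_eq_abs, ← Real.norm_eq_abs, ← Complex.norm_real, ← Complex.norm_real]
      exact_mod_cast hdom
  · rintro ⟨y, hy | ⟨hg, hdom⟩, rfl⟩
    · obtain ⟨t, ht, hz⟩ := (curve_iff_mem_Icc ha hc h y).2 ⟨y, hy, rfl⟩
      by_cases hA : a * y + b = 0
      · have : y = -b / a := by
          rw [eq_div_iff ha.ne']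
          linarith
        rw [this]
        exact (isNonisolatedLimitOfZeros_neg_div ha.ne' hc.ne' hd.ne').1
      · exact (isNonisolatedLimitOfZeros_of_curve ha.ne' hc.ne' hd.ne' ht hz
          (by exact_mod_cast hA)).1
    · exact mem_limitsOfZeros_of_dominated ha.ne' hg (hsimple y hg) hdom

/-! ### Which roots of `g` are dominated -/

theorem xG_eq_of_eq_one {a b c d : ℝ} (ha : a = 1) (hbc : b + c ≠ 0) (y : ℝ) :
    y ^ 2 - (a * y + b) * y - (c * y + d) = 0 ↔ y = xGMinus a b c d := by
  rw [xGMinus, if_pos ha, eq_div_iff hbc, ha]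
  constructor <;> intro h <;> linarith

theorem xG_factor {a b c d : ℝ} (ha : a ≠ 1) (hG : 0 ≤ discG a b c d) (y : ℝ) :
    y ^ 2 - (a * y + b) * y - (c * y + d) =
      (1 - a) * ((y - xGMinus a b c d) * (y - xGPlus a b c d)) := by
  have ha' : 1 - a ≠ 0 := sub_ne_zero.2 (Ne.symm ha)
  have h1 := Real.sq_sqrt hG
  have h2 : |1 - a| ^ 2 = (1 - a) ^ 2 := sq_abs _
  have h3 : |1 - a| ≠ 0 := abs_ne_zero.2 ha'
  have h4 : (Real.sqrt (discG a b c d) / (2 * |1 - a|)) ^ 2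
      = discG a b c d / (4 * (1 - a) ^ 2) := by
    rw [div_pow, mul_pow, h1, h2]
    norm_num
  rw [xGMinus, xGPlus, if_neg ha, if_neg ha]
  have e : (y - ((b + c) / (2 * (1 - a)) - Real.sqrt (discG a b c d) / (2 * |1 - a|))) *
      (y - ((b + c) / (2 * (1 - a)) + Real.sqrt (discG a b c d) / (2 * |1 - a|)))
      = (y - (b + c) / (2 * (1 - a))) ^ 2 - discG a b c d / (4 * (1 - a) ^ 2) := by
    rw [← h4]; ring
  rw [e, discG]
  field_simp
  ring

theorem xGMinus_lt_xGPlus {a b c d : ℝ} (ha : a ≠ 1) (hG : 0 < discG a b c d) :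
    xGMinus a b c d < xGPlus a b c d := by
  rw [xGMinus, xGPlus, if_neg ha, if_neg ha]
  have h1 : 0 < |1 - a| := abs_pos.2 (sub_ne_zero.2 (Ne.symm ha))
  have h2 := Real.sqrt_pos.2 hG
  have : 0 < Real.sqrt (discG a b c d) / (2 * |1 - a|) := by positivity
  linarith

/-- `a d < b c` places the zero `-b/a` of `A` to the left of the zero `-d/c` of `B`. -/
theorem coefA_pos_of_coefB_pos {a b c d y : ℝ} (ha : 0 < a) (hc : 0 < c) (h : a * d < b * c)
    (hB : 0 ≤ c * y + d) : 0 < a * y + b := by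
  by_contra! hA
  nlinarith [mul_nonneg ha.le hB, mul_nonneg hc.le (neg_nonneg.2 hA)]

theorem dominated_of_neg_of_coefB_nonneg {a b c d y : ℝ} (ha : 0 < a) (hc : 0 < c)
    (h : a * d < b * c) (hB : 0 ≤ c * y + d) (hy : y < 0) : |y| < |a * y + b - y| := by
  have hA := coefA_pos_of_coefB_pos ha hc h hB
  rw [abs_of_neg hy, abs_of_pos (by linarith)]
  linarith

/-- A negative root has `B = (1 - a) y² - b y > 0`, hence `A > 0` and it is dominated. A positive
root, present only for `a < 1`, has `y (y - A) = B > 0`, so `|A - y| = y - A < y`. -/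
theorem dominated_roots_of_le_one {a b c d : ℝ} (ha : 0 < a) (hb : 0 < b) (hc : 0 < c)
    (hd : 0 < d) (h : a * d < b * c) (ha1 : a ≤ 1) :
    {y | y ^ 2 - (a * y + b) * y - (c * y + d) = 0 ∧ |y| < |a * y + b - y|} =
      {xGMinus a b c d} := by
  have hneg (y : ℝ) (hg : y ^ 2 - (a * y + b) * y - (c * y + d) = 0) (hy : y < 0) :
      |y| < |a * y + b - y| := by
    refine dominated_of_neg_of_coefB_nonneg ha hc h ?_ hy
    by_contra! hB
    nlinarith [mul_nonneg (sub_nonneg.2 ha1) (neg_nonneg.2 hy.le)]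
  ext y
  rw [Set.mem_ofPred_eq, Set.mem_singleton_iff]
  rcases ha1.eq_or_lt with ha1 | ha1
  · rw [xG_eq_of_eq_one ha1 (by positivity)]
    refine ⟨And.left, fun hy => ⟨hy, hneg y ((xG_eq_of_eq_one ha1 (by positivity) y).2 hy) ?_⟩⟩
    rw [hy, xGMinus, if_pos ha1]
    exact div_neg_of_neg_of_pos (neg_lt_zero.2 hd) (by positivity)
  · have hG := discG_pos hd h.le
    have hfac := xG_factor ha1.ne hG.le
    have hlt := xGMinus_lt_xGPlus ha1.ne hG
    have h0 := hfac 0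
    have hprod : xGMinus a b c d * xGPlus a b c d < 0 := by
      have : 0 < 1 - a := by linarith
      by_contra! hc
      nlinarith [mul_nonneg this.le hc]
    have hm : xGMinus a b c d < 0 := by
      by_contra! hm
      nlinarith [mul_nonneg hm (hm.trans hlt.le)]
    have hp : 0 < xGPlus a b c d := by
      by_contra! hp
      nlinarith
    constructor
    · rintro ⟨hg, hdom⟩
      have hg' := hg
      rw [hfac] at hg'
      rcases mul_eq_zero.1 ((mul_eq_zero.1 hg').resolve_left (by linarith)) with e | e
      · linarith
      · exfalso
        have hy : 0 < y := by linarith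
        have hA : 0 < a * y + b := by positivity
        have hB : 0 < c * y + d := by positivity
        have hAy : a * y + b - y < 0 := by
          by_contra! hAy
          nlinarith [mul_nonneg hy.le hAy]
        rw [abs_of_pos hy, abs_of_neg hAy] at hdom
        linarith
    · rintro rfl
      have hg := hfac (xGMinus a b c d)
      rw [sub_self, zero_mul, mul_zero] at hg
      exact ⟨hg, hneg _ hg hm⟩

/-- For `a > 1` the larger root `x_g⁺` is always dominated, and the smaller root `x_g⁻` is so
exactly if `a > 2` and `Δ_g < Δ_Δ`. -/
theorem dominated_roots_of_one_lt {a b c d : ℝ} (hb : 0 < b) (hc : 0 < c)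
    (hd : 0 < d) (h : a * d < b * c) (ha1 : 1 < a) (y : ℝ) :
    (y ^ 2 - (a * y + b) * y - (c * y + d) = 0 ∧ |y| < |a * y + b - y|) ↔
      y = xGPlus a b c d ∨
        (y = xGMinus a b c d ∧ 2 < a ∧ discG a b c d < discDelta a b c d) := by
  have ha : 0 < a := by linarith
  have hG := discG_pos hd h.le
  have hfac := xG_factor ha1.ne' hG.le
  have hlt := xGMinus_lt_xGPlus ha1.ne' hG
  have ha1' : 1 - a < 0 := by linarith
  have hdc : 0 < d / c := by positivity
  have hcdc : c * (-(d / c)) + d = 0 := by field_simp; ring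
  -- `g > 0` at `-d/c` and the leading coefficient `1 - a` is negative, so `-d/c` separates the two
  -- roots.
  have hbtw : (-(d / c) - xGMinus a b c d) * (-(d / c) - xGPlus a b c d) < 0 := by
    have h1 := hfac (-(d / c))
    rw [hcdc] at h1
    have hA := coefA_pos_of_coefB_pos ha hc h hcdc.ge
    by_contra! h2
    nlinarith [mul_pos hA hdc, sq_nonneg (d / c), mul_nonneg_of_nonpos_of_nonpos ha1'.le
      (neg_nonpos.2 h2), mul_pos hdc hdc]
  have hm : xGMinus a b c d < -(d / c) := by
    by_contra! hm
    nlinarith [mul_nonneg (sub_nonneg.2 hm) (sub_nonneg.2 (hm.trans hlt.le))]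
  have hp : -(d / c) < xGPlus a b c d := by
    by_contra! hp
    nlinarith [mul_nonneg (sub_nonneg.2 hm.le) (sub_nonneg.2 hp)]
  have hroot_neg (y : ℝ) (hg : y ^ 2 - (a * y + b) * y - (c * y + d) = 0) : y < 0 := by
    by_contra! hy
    nlinarith [mul_nonneg hy hy, mul_nonneg hb.le hy, mul_nonneg hc.le hy]
  have hgm : xGMinus a b c d ^ 2 - (a * xGMinus a b c d + b) * xGMinus a b c d
      - (c * xGMinus a b c d + d) = 0 := by rw [hfac]; ring
  have hgp : xGPlus a b c d ^ 2 - (a * xGPlus a b c d + b) * xGPlus a b c d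
      - (c * xGPlus a b c d + d) = 0 := by rw [hfac]; ring
  -- Here `y (y - A) = B < 0` with `y < 0`, so `A - y < 0` and domination reads `A - 2 y < 0`.
  have hdomm : |xGMinus a b c d| < |a * xGMinus a b c d + b - xGMinus a b c d| ↔
      (a - 2) * xGMinus a b c d + b < 0 := by
    have hy := hroot_neg _ hgm
    have hB : c * xGMinus a b c d + d < 0 := by
      have := mul_lt_mul_of_pos_left hm hc
      linarith
    have hAy : a * xGMinus a b c d + b - xGMinus a b c d < 0 := by
      by_contra! hAy
      nlinarith [mul_nonneg hAy (neg_nonneg.2 hy.le)]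
    rw [abs_of_neg hy, abs_of_neg hAy]
    constructor <;> intro <;> linarith
  have hcond : (a - 2) * xGMinus a b c d + b < 0 ↔
      2 < a ∧ discG a b c d < discDelta a b c d := by
    have hy := hroot_neg _ hgm
    rcases le_or_gt a 2 with ha2 | ha2
    · refine iff_of_false (fun hlt => ?_) fun h => absurd h.1 ha2.not_gt
      nlinarith [mul_nonneg (sub_nonneg.2 ha2) (neg_nonneg.2 hy.le)]
    · have ha2' : 0 < a - 2 := by linarith
      -- The zero of `A - 2 y`. Since `Δ_Δ - Δ_g = (a - 2)² g(x)` and `x < x_g⁺`, the sign of this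
      -- difference tells on which side of `x_g⁻` the point `x` lies.
      set x := -(b / (a - 2)) with hx
      have hxa : (a - 2) * x = -b := by rw [hx]; field_simp
      have hxp : x < xGPlus a b c d := by
        refine lt_trans ?_ hp
        rw [hx, neg_lt_neg_iff, div_lt_div_iff₀ hc ha2']
        linarith
      have hval : discDelta a b c d - discG a b c d
          = (a - 2) ^ 2 * (x ^ 2 - (a * x + b) * x - (c * x + d)) := by
        unfold discDelta discG
        linear_combination ((a - 1) * ((a - 2) * x - b) + (b + c) * (a - 2)) * hxa
      rw [hfac] at hval
      have h1 : (a - 2) * xGMinus a b c d + b < 0 ↔ xGMinus a b c d < x := by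
        rw [← sub_neg (a := xGMinus a b c d)]
        have : (a - 2) * xGMinus a b c d + b = (a - 2) * (xGMinus a b c d - x) := by
          linear_combination hxa
        rw [this]
        exact ⟨fun h => (pos_iff_neg_of_mul_neg h).1 ha2', mul_neg_of_pos_of_neg ha2'⟩
      rw [h1, ← sub_pos (b := discG a b c d), hval]
      have e : (a - 2) ^ 2 * ((1 - a) * ((x - xGMinus a b c d) * (x - xGPlus a b c d)))
          = ((a - 2) ^ 2 * ((a - 1) * (xGPlus a b c d - x))) * (x - xGMinus a b c d) := by ring
      have hpos : 0 < (a - 2) ^ 2 * ((a - 1) * (xGPlus a b c d - x)) :=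
        mul_pos (pow_pos ha2' 2) (mul_pos (by linarith) (by linarith))
      rw [e, mul_pos_iff_of_pos_left hpos, sub_pos]
      exact ⟨fun h => ⟨ha2, h⟩, And.right⟩
  constructor
  · rintro ⟨hg, hdom⟩
    have hg' := hg
    rw [hfac] at hg'
    rcases mul_eq_zero.1 ((mul_eq_zero.1 hg').resolve_left ha1'.ne) with e | e
    · have hy : y = xGMinus a b c d := by linarith
      rw [hy, hdomm, hcond] at hdom
      exact Or.inr ⟨hy, hdom⟩
    · exact Or.inl (by linarith)
  · rintro (rfl | ⟨rfl, hcases⟩)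
    · refine ⟨hgp, dominated_of_neg_of_coefB_nonneg ha hc h ?_ (hroot_neg _ hgp)⟩
      have := mul_lt_mul_of_pos_left hp hc
      linarith
    · exact ⟨hgm, hdomm.2 (hcond.2 hcases)⟩

end RootGeometry

theorem theorem2p2 (a b c d : ℝ) (ha : 0 < a) (hb : 0 < b) (hc : 0 < c) (hd : 0 < d) :
    (RootGeometry.IsNonisolatedLimitOfZeros (RootGeometry.W a b c d) ((-b / a : ℝ) : ℂ) ∧
      RootGeometry.IsNonisolatedLimitOfZeros (RootGeometry.W a b c d)
        (RootGeometry.xDeltaMinus a b c d) ∧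
      RootGeometry.IsNonisolatedLimitOfZeros (RootGeometry.W a b c d)
        (RootGeometry.xDeltaPlus a b c d)) ∧
    (a * d < b * c →
      (a ≤ 1 →
        RootGeometry.limitsOfZeros (RootGeometry.W a b c d) =
          Complex.ofReal '' (Set.Icc (RootGeometry.xDeltaMinusReal a b c d)
            (RootGeometry.xDeltaPlusReal a b c d) ∪ {RootGeometry.xGMinus a b c d})) ∧
      ((1 < a ∧ a ≤ 2) ∨
          (2 < a ∧ RootGeometry.discDelta a b c d ≤ RootGeometry.discG a b c d) →
        RootGeometry.limitsOfZeros (RootGeometry.W a b c d) =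
          Complex.ofReal '' (Set.Icc (RootGeometry.xDeltaMinusReal a b c d)
            (RootGeometry.xDeltaPlusReal a b c d) ∪ {RootGeometry.xGPlus a b c d})) ∧
      (2 < a ∧ RootGeometry.discG a b c d < RootGeometry.discDelta a b c d →
        RootGeometry.limitsOfZeros (RootGeometry.W a b c d) =
          Complex.ofReal '' (Set.Icc (RootGeometry.xDeltaMinusReal a b c d)
            (RootGeometry.xDeltaPlusReal a b c d) ∪
              {RootGeometry.xGMinus a b c d, RootGeometry.xGPlus a b c d}))) := by
  refine ⟨⟨RootGeometry.isNonisolatedLimitOfZeros_neg_div ha.ne' hc.ne' hd.ne',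
    RootGeometry.isNonisolatedLimitOfZeros_of_discriminant_eq_zero ha.ne' hc.ne' hd.ne'
      (RootGeometry.discriminant_xDeltaMinus b c d ha.ne'),
    RootGeometry.isNonisolatedLimitOfZeros_of_discriminant_eq_zero ha.ne' hc.ne' hd.ne'
      (RootGeometry.discriminant_xDeltaPlus b c d ha.ne')⟩, fun h => ⟨fun ha1 => ?_, ?_, ?_⟩⟩
  · rw [RootGeometry.limitsOfZeros_eq ha hc hd h,
      RootGeometry.dominated_roots_of_le_one ha hb hc hd h ha1]
  · intro hcases
    have ha1 : 1 < a := by rcases hcases with h | h <;> linarith [h.1]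
    rw [RootGeometry.limitsOfZeros_eq ha hc hd h]
    congr 2
    ext y
    rw [Set.mem_ofPred_eq, RootGeometry.dominated_roots_of_one_lt hb hc hd h ha1,
      Set.mem_singleton_iff]
    refine or_iff_left ?_
    rintro ⟨-, ha2, hlt⟩
    rcases hcases with h | h
    · exact absurd h.2 ha2.not_ge
    · exact absurd h.2 hlt.not_ge
  · rintro ⟨ha2, hlt⟩
    rw [RootGeometry.limitsOfZeros_eq ha hc hd h]
    congr 2
    ext y
    rw [Set.mem_ofPred_eq, RootGeometry.dominated_roots_of_one_lt hb hc hd h (by linarith),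
      Set.mem_insert_iff, Set.mem_singleton_iff]
    tauto
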